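/- For a complex $p\times q$ matrix $X$, let its singular values $\sigma_1(X)\ge\dots\ge\sigma_{\max\{p,q\}}(X)\ge 0$ be the nonnegative square roots of the eigenvalues of $XX^*$ or $X^*X$, whichever has the larger size (so a non-square matrix always has $0$ among its singular values); let $\sigma(X)$ be the set of these numbers and $\|X\|$ the spectral norm. Let $m,n,k,\ell\ge 1$, and let $G_1\in\mathbb C^{m\times k}$, $E_1\in\mathbb C^{m\times \ell}$, $E_2\in\mathbb C^{n\times k}$, $G_2\in\mathbb C^{n\times \ell}$. Let $$B=\begin{pmatrix}G_1&E_1\\E_2&G_2\end{pmatrix},\qquad \widetilde B=\begin{pmatrix}G_1&0\\0&G_2\end{pmatrix}$$ have singular values $\sigma_1\ge\dots\ge\sigma_{\max\{m+n,k+\ell\}}$ and $\widetilde\sigma_1\ge\dots\ge\widetilde\sigma_{\max\{m+n,k+\ell\}}$, respectively, and put $\epsilon=\max\{\|E_1\|,\|E_2\|\}$. Every $\widetilde\sigma_i$ lies in $\sigma(G_1)\cup\sigma(G_2)$. Define $$\eta_i=\begin{cases}\min_{\mu_2\in\sigma(G_2)}|\widetilde\sigma_i-\mu_2|,&\widetilde\sigma_i\in\sigma(G_1),\\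 \min_{\mu_1\in\sigma(G_1)}|\widetilde\sigma_i-\mu_1|,&\widetilde\sigma_i\in\sigma(G_2)\end{cases}$$ (if $\widetilde\sigma_i$ lies in both sets, both formulas give $0$), and $$\eta=\min_{1\le i\le\min\{m+n,k+\ell\}}\eta_i,\qquad \eta'=\min_{\mu_1\in\sigma(G_1),\,\mu_2\in\sigma(G_2)}|\mu_1-\mu_2| .$$ Then $\eta'\le\eta$, and $\eta'=\eta$ unless ($m>k$ and $n>\ell$) or ($m<k$ and $n<\ell$). For $i=1,\dots,\min\{m+n,k+\ell\}$, $$|\sigma_i-\widetilde\sigma_i|\le\frac{2\epsilon^2}{\eta_i+\sqrt{\eta_i^2+4\epsilon^2}}\le\frac{2\epsilon^2}{\eta+\sqrt{\eta^2+4\epsilon^2}}\le\frac{2\epsilon^2}{\eta'+\sqrt{\eta'^2+4\epsilon^2}},$$ where the fractions are read as $0$ when $\epsilon=0$, and $\sigma_i=\widetilde\sigma_i=0$ for $\min\{m+n,k+\ell\}<i\le\max\{m+n,k+\ell\}$. -/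

import Mathlib

-- `‖X‖` for a matrix `X` is the spectral norm (operator norm for the Euclidean norms).
open scoped Matrix.Norms.L2Operator

namespace BlockSVD

noncomputable section

/-- The singular values of a complex matrix `X` with `p` rows and `q` columns: the sequence of
length `max p q`, in decreasing order (indexed from `0`), of the nonnegative square roots of the
eigenvalues of `X Xᴴ` or `Xᴴ X`, whichever has the larger size. -/
def sv {P Q : Type*} [Fintype P] [Fintype Q] [DecidableEq P] [DecidableEq Q]
    (X : Matrix P Q ℂ) (i : Fin (max (Fintype.card P) (Fintype.card Q))) : ℝ :=
  if h : Fintype.card Q ≤ Fintype.card P then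
    √((Matrix.isHermitian_mul_conjTranspose_self X).eigenvalues₀ (i.cast (max_eq_left h)))
  else
    √((Matrix.isHermitian_conjTranspose_mul_self X).eigenvalues₀
      (i.cast (max_eq_right (le_of_not_ge h))))

/-- The set of the singular values of `X`. -/
def svSet {P Q : Type*} [Fintype P] [Fintype Q] [DecidableEq P] [DecidableEq Q]
    (X : Matrix P Q ℂ) : Set ℝ :=
  Set.range (sv X)

/-- The distance from `x` to the singular values of `X`. For nonempty `P`, `Q` this is the minimum
of a nonempty finite family. -/
def svDist {P Q : Type*} [Fintype P] [Fintype Q] [DecidableEq P] [DecidableEq Q]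
    (x : ℝ) (X : Matrix P Q ℂ) : ℝ :=
  ⨅ j, |x - sv X j|

/-- Indices of the `max (m + n) (k + l)` singular values of an `(m + n)` by `(k + l)` block
matrix. -/
abbrev Idx (m n k l : ℕ) : Type :=
  Fin (max (Fintype.card (Fin m ⊕ Fin n)) (Fintype.card (Fin k ⊕ Fin l)))

/-- The unperturbed matrix, with diagonal blocks `G₁`, `G₂` and off-diagonal blocks zero. -/
def diagBlocks {m n k l : ℕ} (G₁ : Matrix (Fin m) (Fin k) ℂ) (G₂ : Matrix (Fin n) (Fin l) ℂ) :
    Matrix (Fin m ⊕ Fin n) (Fin k ⊕ Fin l) ℂ :=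
  Matrix.fromBlocks G₁ 0 0 G₂

open Classical in
/-- The gap `η_i`: the distance from the `i`-th singular value of `diag(G₁, G₂)` to the singular
values of the block of which it is not a singular value. (A common singular value of both blocks
has gap `0`, computed with either block.) -/
def gap {m n k l : ℕ} (G₁ : Matrix (Fin m) (Fin k) ℂ) (G₂ : Matrix (Fin n) (Fin l) ℂ)
    (i : Idx m n k l) : ℝ :=
  if sv (diagBlocks G₁ G₂) i ∈ svSet G₁ then svDist (sv (diagBlocks G₁ G₂) i) G₂
  else svDist (sv (diagBlocks G₁ G₂) i) G₁

/-- The gap `η`: the minimum of the gaps `η_i` over the first `min (m + n) (k + l)` indices. -/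
def minGap {m n k l : ℕ} (G₁ : Matrix (Fin m) (Fin k) ℂ) (G₂ : Matrix (Fin n) (Fin l) ℂ) : ℝ :=
  ⨅ i : {i : Idx m n k l // (i : ℕ) < min (m + n) (k + l)}, gap G₁ G₂ i.1

/-- The minimum of `|μ₁ - μ₂|` over the singular values `μ₁` of `G₁` and `μ₂` of `G₂`. -/
def pairGap {m n k l : ℕ} (G₁ : Matrix (Fin m) (Fin k) ℂ) (G₂ : Matrix (Fin n) (Fin l) ℂ) : ℝ :=
  ⨅ j₁, svDist (sv G₁ j₁) G₂

/-- The bound `2 ε² / (η + √(η² + 4 ε²))`, which is `0` when `ε = 0`. -/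
def bound (ε η : ℝ) : ℝ :=
  2 * ε ^ 2 / (η + √(η ^ 2 + 4 * ε ^ 2))

end

end BlockSVD

/-! The Jordan–Wielandt matrix `wielandt X` is Hermitian, and its eigenvalues are the `±σ` of `X` up
to zeros (`eigs_wielandt`). Regrouping coordinates turns that of `B` into a Hermitian block matrix
with diagonal blocks `wielandt G₁`, `wielandt G₂` and an off-diagonal block `F` of norm at most `ε`,
so the claim becomes one about Hermitian eigenvalues.

The engine is `IsDiagonalizedBy.card_lt_le`: if `ε² ≤ (τ - α)(τ - β)` with `α, β ≤ τ`, a dimension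
count bounds the number of eigenvalues above `τ` by the number above `α` in one block plus the
number above `β` in the other. Let `μ = σ̃_i` and let `g` be its gap. One block has no eigenvalue
within distance less than `g` of `μ`, so its threshold may be lowered from `μ` to `μ - g` without
changing its count. With `τ = μ + δ` the condition reads `ε² ≤ δ (δ + g)`, and `bound ε g` is the
nonnegative root of equality. The lower estimate is the mirror image.

The two gaps `η` and `η'` can differ only through a zero common to both blocks, which is settled by
comparing ranks with sizes. -/

namespace BlockSVD

open Matrix

set_option linter.unusedSectionVars false

/-! ### Spectrum of the Jordan–Wielandt matrix -/

section Spectra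

open Polynomial

variable {P Q : Type*} [Fintype P] [Fintype Q] [DecidableEq P] [DecidableEq Q]

/-- The real parts of the eigenvalues of a square matrix, with algebraic multiplicities. -/
noncomputable def eigs (A : Matrix P P ℂ) : Multiset ℝ :=
  A.charpoly.roots.map Complex.re

/-- The multiset of the singular values. -/
noncomputable def svs (X : Matrix P Q ℂ) : Multiset ℝ :=
  Finset.univ.val.map (sv X)

/-- The Jordan–Wielandt matrix of `X`. -/
def wielandt (X : Matrix P Q ℂ) : Matrix (P ⊕ Q) (P ⊕ Q) ℂ :=
  fromBlocks 0 X Xᴴ 0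

theorem wielandt_isHermitian (X : Matrix P Q ℂ) : (wielandt X).IsHermitian := by
  simp [wielandt, IsHermitian, fromBlocks_conjTranspose]

theorem sv_nonneg (X : Matrix P Q ℂ) (i) : 0 ≤ sv X i := by
  unfold sv; split_ifs <;> exact Real.sqrt_nonneg _

theorem sv_antitone (X : Matrix P Q ℂ) : Antitone (sv X) := by
  intro i j hij
  unfold sv
  split_ifs
  · exact Real.sqrt_le_sqrt (IsHermitian.eigenvalues₀_antitone _ (by simpa using hij))
  · exact Real.sqrt_le_sqrt (IsHermitian.eigenvalues₀_antitone _ (by simpa using hij))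

open scoped ComplexOrder in
theorem eigenvalues₀_nonneg {A : Matrix P P ℂ} (hA : A.PosSemidef) (i) :
    0 ≤ hA.1.eigenvalues₀ i := by
  have h := hA.eigenvalues_nonneg (Fintype.equivOfCardEq (Fintype.card_fin _) i)
  simpa [IsHermitian.eigenvalues] using h

theorem charpoly_eq_prod_eigenvalues₀ {A : Matrix P P ℂ} (hA : A.IsHermitian) :
    A.charpoly = ∏ i, (X - C (hA.eigenvalues₀ i : ℂ)) := by
  rw [hA.charpoly_eq]
  exact Fintype.prod_equiv (Fintype.equivOfCardEq (Fintype.card_fin _)).symm _ _ fun i => rfl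

open scoped ComplexOrder in
theorem charpoly_gram_eq_prod_left (M : Matrix P Q ℂ) (h : Fintype.card Q ≤ Fintype.card P) :
    (M * Mᴴ).charpoly = ∏ i, (X - C ((sv M i : ℂ) ^ 2)) := by
  rw [charpoly_eq_prod_eigenvalues₀ (isHermitian_mul_conjTranspose_self M)]
  refine (Fintype.prod_equiv (finCongr (max_eq_left h)) _ _ fun i => ?_).symm
  have h0 := eigenvalues₀_nonneg (posSemidef_self_mul_conjTranspose M) (i.cast (max_eq_left h))
  rw [sv, dif_pos h, ← Complex.ofReal_pow, Real.sq_sqrt h0]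
  rfl

open scoped ComplexOrder in
theorem charpoly_gram_eq_prod_right (M : Matrix P Q ℂ) (h : ¬ Fintype.card Q ≤ Fintype.card P) :
    (Mᴴ * M).charpoly = ∏ i, (X - C ((sv M i : ℂ) ^ 2)) := by
  rw [charpoly_eq_prod_eigenvalues₀ (isHermitian_conjTranspose_mul_self M)]
  have h' := max_eq_right (le_of_not_ge h)
  refine (Fintype.prod_equiv (finCongr h') _ _ fun i => ?_).symm
  have h0 := eigenvalues₀_nonneg (posSemidef_conjTranspose_mul_self M) (i.cast h')
  rw [sv, dif_neg h, ← Complex.ofReal_pow, Real.sq_sqrt h0]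
  rfl

theorem charmatrix_wielandt (M : Matrix P Q ℂ) :
    charmatrix (wielandt M) =
      fromBlocks (scalar P X) (-M.map C) (-Mᴴ.map C) (scalar Q X) := by
  rw [wielandt, charmatrix_fromBlocks]
  simp [charmatrix]

theorem expand_charpoly {A : Matrix P P ℂ} :
    expand ℂ 2 A.charpoly = det (scalar P (X ^ 2) - A.map C) := by
  rw [charpoly, charmatrix, expand_eq_comp_X_pow, ← coe_compRingHom_apply, RingHom.map_det]
  congr 1
  ext i j
  by_cases h : i = j <;> simp [h]

/-- Multiplying `X - wielandt M` on the right by a block triangular matrix clears the upper right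
block; then take determinants. Keeping the powers of `X` on both sides avoids division and covers
both shapes of `M`. -/
theorem X_pow_mul_charpoly_wielandt_right (M : Matrix P Q ℂ) :
    X ^ Fintype.card Q * (wielandt M).charpoly =
      X ^ Fintype.card P * expand ℂ 2 (Mᴴ * M).charpoly := by
  have key : charmatrix (wielandt M) * fromBlocks 1 (M.map C) 0 (scalar Q X) =
      fromBlocks (scalar P X) 0 (-Mᴴ.map C) (scalar Q (X ^ 2) - (Mᴴ * M).map C) := by
    rw [charmatrix_wielandt, fromBlocks_multiply]
    congr 1
    · simp
    · ext i j
      rw [Matrix.neg_mul, Matrix.add_apply, Matrix.neg_apply, scalar_apply, scalar_apply,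
        diagonal_mul, mul_diagonal, mul_comm, add_neg_cancel, Matrix.zero_apply]
    · simp
    · rw [Matrix.map_mul, Matrix.neg_mul, ← map_mul, pow_two]; abel
  have := congrArg det key
  rw [det_mul, det_fromBlocks_zero₂₁, det_fromBlocks_zero₁₂, ← expand_charpoly] at this
  simpa [charpoly, mul_comm] using this

theorem X_pow_mul_charpoly_wielandt_left (M : Matrix P Q ℂ) :
    X ^ Fintype.card P * (wielandt M).charpoly =
      X ^ Fintype.card Q * expand ℂ 2 (M * Mᴴ).charpoly := by
  have h := X_pow_mul_charpoly_wielandt_right Mᴴ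
  have e : (wielandt Mᴴ).charpoly = (wielandt M).charpoly := by
    rw [← charpoly_reindex (Equiv.sumComm P Q)]
    congr 1
    ext (i | i) (j | j) <;> simp [wielandt]
  simpa [e] using h

theorem X_pow_mul_charpoly_wielandt (M : Matrix P Q ℂ) :
    X ^ (max (Fintype.card P) (Fintype.card Q)) * (wielandt M).charpoly =
      X ^ (min (Fintype.card P) (Fintype.card Q)) *
        ∏ i, ((X - C (sv M i : ℂ)) * (X - C (-sv M i : ℂ))) := by
  have e : expand ℂ 2 (∏ i, (X - C ((sv M i : ℂ) ^ 2))) =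
      ∏ i, ((X - C (sv M i : ℂ)) * (X - C (-sv M i : ℂ))) := by
    rw [map_prod]
    refine Finset.prod_congr rfl fun i _ => ?_
    simp only [map_sub, expand_X, expand_C, map_neg, map_pow]
    ring
  by_cases h : Fintype.card Q ≤ Fintype.card P
  · rw [← e, ← charpoly_gram_eq_prod_left M h, max_eq_left h, min_eq_right h,
      X_pow_mul_charpoly_wielandt_left]
  · rw [← e, ← charpoly_gram_eq_prod_right M h, max_eq_right (le_of_not_ge h),
      min_eq_left (le_of_not_ge h), X_pow_mul_charpoly_wielandt_right]

/-- The eigenvalues of the Jordan–Wielandt matrix are the `±σ`, up to zeros. -/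
theorem eigs_wielandt (M : Matrix P Q ℂ) :
    Multiset.replicate (max (Fintype.card P) (Fintype.card Q)) 0 + eigs (wielandt M) =
      Multiset.replicate (min (Fintype.card P) (Fintype.card Q)) 0 +
        (svs M + (svs M).map Neg.neg) := by
  have hne : ∀ i, X - C (sv M i : ℂ) ≠ 0 := fun i => X_sub_C_ne_zero _
  have hne' : ∀ i, X - C (-sv M i : ℂ) ≠ 0 := fun i => X_sub_C_ne_zero _
  -- Taking roots makes the product identity an identity of multisets; the powers of `X` become the
  -- padding zeros.
  have h := congrArg (fun p : ℂ[X] => p.roots.map Complex.re) (X_pow_mul_charpoly_wielandt M)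
  have h1 : (∏ i, (X - C (sv M i : ℂ))) ≠ 0 := Finset.prod_ne_zero_iff.2 fun i _ => hne i
  have h2 : (∏ i, (X - C (-sv M i : ℂ))) ≠ 0 := Finset.prod_ne_zero_iff.2 fun i _ => hne' i
  rw [Finset.prod_mul_distrib,
    roots_mul (mul_ne_zero (pow_ne_zero _ X_ne_zero) (charpoly_monic _).ne_zero),
    roots_mul (mul_ne_zero (pow_ne_zero _ X_ne_zero) (mul_ne_zero h1 h2)),
    roots_mul (mul_ne_zero h1 h2), roots_prod _ _ h1, roots_prod _ _ h2] at h
  simp only [roots_pow, roots_X, roots_X_sub_C, Multiset.map_add, Multiset.nsmul_singleton,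
    Multiset.map_replicate, Complex.zero_re, Multiset.bind_singleton, Multiset.map_map] at h
  simpa [eigs, svs, Multiset.map_map, Function.comp_def] using h

theorem eigs_fromBlocks_diag (A : Matrix P P ℂ) (D : Matrix Q Q ℂ) :
    eigs (fromBlocks A 0 0 D) = eigs A + eigs D := by
  rw [eigs, charpoly_fromBlocks_zero₁₂,
    roots_mul (mul_ne_zero (charpoly_monic _).ne_zero (charpoly_monic _).ne_zero)]
  simp [eigs]

theorem eigs_reindex (e : P ≃ Q) (A : Matrix P P ℂ) : eigs (reindex e e A) = eigs A := by
  rw [eigs, charpoly_reindex, eigs]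

theorem card_eigs (A : Matrix P P ℂ) : (eigs A).card = Fintype.card P := by
  rw [eigs, Multiset.card_map, ← (IsAlgClosed.splits A.charpoly).natDegree_eq_card_roots,
    charpoly_natDegree_eq_dim]

theorem eigs_eq {A : Matrix P P ℂ} (hA : A.IsHermitian) :
    eigs A = Finset.univ.val.map hA.eigenvalues := by
  rw [eigs, hA.roots_charpoly_eq_eigenvalues, Multiset.map_map]
  rfl

end Spectra

/-! ### Eigenvalue counts for Hermitian block matrices -/

section Counting

variable {P Q : Type*} [Fintype P] [Fintype Q] [DecidableEq P] [DecidableEq Q]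

/-- The square of the Euclidean norm. -/
noncomputable def normSq (x : P → ℂ) : ℝ := ∑ i, ‖x i‖ ^ 2

theorem normSq_nonneg (x : P → ℂ) : 0 ≤ normSq x :=
  Finset.sum_nonneg fun _ _ => by positivity

theorem star_dotProduct_self (x : P → ℂ) : star x ⬝ᵥ x = (normSq x : ℂ) := by
  simp only [dotProduct, normSq, Pi.star_apply, Complex.ofReal_sum, Complex.ofReal_pow]
  exact Finset.sum_congr rfl fun i _ => Complex.conj_mul' _

theorem normSq_sum (x : P ⊕ Q → ℂ) :
    normSq x = normSq (x ∘ Sum.inl) + normSq (x ∘ Sum.inr) := by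
  simp [normSq]

theorem norm_sq_toLp (x : P → ℂ) : ‖(WithLp.toLp 2 x : EuclideanSpace ℂ P)‖ ^ 2 = normSq x := by
  simp [EuclideanSpace.norm_sq_eq, normSq]

theorem normSq_mulVec_le (M : Matrix P Q ℂ) (x : Q → ℂ) :
    normSq (M *ᵥ x) ≤ ‖M‖ ^ 2 * normSq x := by
  rw [← norm_sq_toLp, ← norm_sq_toLp, ← mul_pow]
  exact pow_le_pow_left₀ (norm_nonneg _) (l2_opNorm_mulVec M (WithLp.toLp 2 x)) 2

theorem norm_dotProduct_sq_le (x y : P → ℂ) : ‖star x ⬝ᵥ y‖ ^ 2 ≤ normSq x * normSq y := by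
  have h := norm_inner_le_norm (𝕜 := ℂ) (WithLp.toLp 2 x : EuclideanSpace ℂ P) (WithLp.toLp 2 y)
  rw [EuclideanSpace.inner_toLp_toLp, dotProduct_comm] at h
  rw [← norm_sq_toLp, ← norm_sq_toLp, ← mul_pow]
  exact pow_le_pow_left₀ (norm_nonneg _) h 2

/-- `A = U diag(d) Uᴴ` with `U` unitary and `d` real. -/
structure IsDiagonalizedBy (A U : Matrix P P ℂ) (d : P → ℝ) : Prop where
  conjTranspose_mul : Uᴴ * U = 1
  eq : A = U * diagonal (fun i => (d i : ℂ)) * Uᴴ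

namespace IsDiagonalizedBy

variable {A U : Matrix P P ℂ} {d : P → ℝ}

theorem mul_conjTranspose (h : IsDiagonalizedBy A U d) : U * Uᴴ = 1 :=
  mul_eq_one_comm.1 h.conjTranspose_mul

theorem neg (h : IsDiagonalizedBy A U d) : IsDiagonalizedBy (-A) U (-d) where
  conjTranspose_mul := h.conjTranspose_mul
  eq := by
    have : (diagonal fun i => (((-d) i : ℝ) : ℂ)) = -diagonal (fun i => (d i : ℂ)) := by
      ext i j; by_cases hij : i = j <;> simp [hij]
    rw [this, Matrix.mul_neg, Matrix.neg_mul, ← h.eq]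

theorem normSq_coords (h : IsDiagonalizedBy A U d) (x : P → ℂ) : normSq (Uᴴ *ᵥ x) = normSq x := by
  have : (normSq (Uᴴ *ᵥ x) : ℂ) = normSq x := by
    rw [← star_dotProduct_self, ← star_dotProduct_self, star_mulVec, conjTranspose_conjTranspose,
      ← dotProduct_mulVec, mulVec_mulVec, h.mul_conjTranspose, one_mulVec]
  exact_mod_cast this

theorem form_eq (h : IsDiagonalizedBy A U d) (x : P → ℂ) :
    (star x ⬝ᵥ A *ᵥ x).re = ∑ i, d i * ‖(Uᴴ *ᵥ x) i‖ ^ 2 := by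
  have : star x ⬝ᵥ A *ᵥ x = ((∑ i, d i * ‖(Uᴴ *ᵥ x) i‖ ^ 2 : ℝ) : ℂ) := by
    conv_lhs => rw [h.eq, Matrix.mul_assoc, ← mulVec_mulVec, dotProduct_mulVec]
    rw [show star x ᵥ* U = star (Uᴴ *ᵥ x) by rw [star_mulVec, conjTranspose_conjTranspose],
      ← mulVec_mulVec]
    simp only [dotProduct, mulVec_diagonal, Pi.star_apply, Complex.ofReal_sum, Complex.ofReal_mul,
      Complex.ofReal_pow]
    refine Finset.sum_congr rfl fun i _ => ?_
    rw [← Complex.conj_mul']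
    simp only [Complex.star_def]
    ring
  rw [this, Complex.ofReal_re]

theorem form_le (h : IsDiagonalizedBy A U d) {α : ℝ} {x : P → ℂ}
    (hx : ∀ i, α < d i → (Uᴴ *ᵥ x) i = 0) : (star x ⬝ᵥ A *ᵥ x).re ≤ α * normSq x := by
  rw [h.form_eq, ← h.normSq_coords, normSq, Finset.mul_sum]
  refine Finset.sum_le_sum fun i _ => ?_
  by_cases hi : α < d i
  · simp [hx i hi]
  · exact mul_le_mul_of_nonneg_right (not_lt.1 hi) (by positivity)

theorem lt_form (h : IsDiagonalizedBy A U d) {τ : ℝ} {x : P → ℂ} (hx0 : x ≠ 0)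
    (hx : ∀ i, ¬ τ < d i → (Uᴴ *ᵥ x) i = 0) : τ * normSq x < (star x ⬝ᵥ A *ᵥ x).re := by
  rw [h.form_eq, ← h.normSq_coords, normSq, Finset.mul_sum]
  have hne : Uᴴ *ᵥ x ≠ 0 := by
    intro h0
    apply hx0
    rw [← one_mulVec x, ← h.mul_conjTranspose, ← mulVec_mulVec, h0, mulVec_zero]
  obtain ⟨j, hj⟩ := Function.ne_iff.1 hne
  refine Finset.sum_lt_sum (fun i _ => ?_) ⟨j, Finset.mem_univ j, ?_⟩
  · by_cases hi : τ < d i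
    · exact mul_le_mul_of_nonneg_right hi.le (by positivity)
    · simp [hx i hi]
  · have hj' : τ < d j := by
      by_contra hc
      exact hj (hx j hc)
    have : 0 < ‖(Uᴴ *ᵥ x) j‖ := norm_pos_iff.2 hj
    exact mul_lt_mul_of_pos_right hj' (by positivity)

end IsDiagonalizedBy

theorem exists_isDiagonalizedBy {A : Matrix P P ℂ} (hA : A.IsHermitian) :
    ∃ U, IsDiagonalizedBy A U hA.eigenvalues := by
  refine ⟨hA.eigenvectorUnitary, ?_, ?_⟩
  · exact Unitary.coe_star_mul_self hA.eigenvectorUnitary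
  · conv_lhs => rw [hA.spectral_theorem, Unitary.conjStarAlgAut_apply]
    rfl

/-- The cross term is at most `2ε‖y‖‖z‖`, and the condition on `τ` makes the 2 × 2 form with
diagonal `τ - α`, `τ - β` and off-diagonal `-ε` positive semidefinite. -/
theorem form_fromBlocks_le {H₁ : Matrix P P ℂ} {H₂ : Matrix Q Q ℂ} {F : Matrix P Q ℂ}
    {ε α β τ : ℝ} (hF : ∀ z, normSq (F *ᵥ z) ≤ ε ^ 2 * normSq z)
    (hα : α ≤ τ) (hβ : β ≤ τ) (hτ : ε ^ 2 ≤ (τ - α) * (τ - β)) {x : P ⊕ Q → ℂ}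
    (h₁ : (star (x ∘ Sum.inl) ⬝ᵥ H₁ *ᵥ (x ∘ Sum.inl)).re ≤ α * normSq (x ∘ Sum.inl))
    (h₂ : (star (x ∘ Sum.inr) ⬝ᵥ H₂ *ᵥ (x ∘ Sum.inr)).re ≤ β * normSq (x ∘ Sum.inr)) :
    (star x ⬝ᵥ fromBlocks H₁ F Fᴴ H₂ *ᵥ x).re ≤ τ * normSq x := by
  set y := x ∘ Sum.inl
  set z := x ∘ Sum.inr
  have hx : x = Sum.elim y z := (Sum.elim_comp_inl_inr x).symm
  have hform : (star x ⬝ᵥ fromBlocks H₁ F Fᴴ H₂ *ᵥ x).re =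
      (star y ⬝ᵥ H₁ *ᵥ y).re + (star z ⬝ᵥ H₂ *ᵥ z).re + 2 * (star y ⬝ᵥ F *ᵥ z).re := by
    have hs : star (Sum.elim y z) = Sum.elim (star y) (star z) := by
      funext i; cases i <;> rfl
    have hc : star z ⬝ᵥ Fᴴ *ᵥ y = star (star y ⬝ᵥ F *ᵥ z) := by
      rw [star_dotProduct, star_mulVec, conjTranspose_conjTranspose, ← dotProduct_mulVec]
    rw [hx, fromBlocks_mulVec, hs, sumElim_dotProduct_sumElim]
    simp only [Sum.elim_comp_inl, Sum.elim_comp_inr, dotProduct_add, hc, Complex.add_re,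
      Complex.star_def, Complex.conj_re]
    ring
  have hre : (star y ⬝ᵥ F *ᵥ z).re ^ 2 ≤ ((τ - α) * normSq y) * ((τ - β) * normSq z) := by
    have h3 := norm_dotProduct_sq_le y (F *ᵥ z)
    have h4 : (star y ⬝ᵥ F *ᵥ z).re ^ 2 ≤ ‖star y ⬝ᵥ F *ᵥ z‖ ^ 2 :=
      sq_le_sq' (by linarith [(abs_le.1 (Complex.abs_re_le_norm (star y ⬝ᵥ F *ᵥ z))).1])
        (Complex.re_le_norm _)
    calc _ ≤ normSq y * normSq (F *ᵥ z) := h4.trans h3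
      _ ≤ normSq y * ((τ - α) * (τ - β) * normSq z) :=
        mul_le_mul_of_nonneg_left ((hF z).trans
          (mul_le_mul_of_nonneg_right hτ (normSq_nonneg z))) (normSq_nonneg y)
      _ = _ := by ring
  have ha : 0 ≤ (τ - α) * normSq y := mul_nonneg (sub_nonneg.2 hα) (normSq_nonneg y)
  have hb : 0 ≤ (τ - β) * normSq z := mul_nonneg (sub_nonneg.2 hβ) (normSq_nonneg z)
  -- AM–GM: `4ab ≤ (a + b)²`, with `a`, `b` the two factors in `hre`.
  have h2 : 2 * (star y ⬝ᵥ F *ᵥ z).re ≤ (τ - α) * normSq y + (τ - β) * normSq z := by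
    refine le_of_sq_le_sq (by nlinarith [sq_nonneg ((τ - α) * normSq y - (τ - β) * normSq z)])
      (add_nonneg ha hb)
  rw [hform, normSq_sum x]
  linarith

/-- Eigenvalues of a Hermitian block matrix above a threshold are no more numerous than those of
the diagonal blocks above suitably lowered thresholds. -/
theorem IsDiagonalizedBy.card_lt_le {H₁ : Matrix P P ℂ} {H₂ : Matrix Q Q ℂ} {F : Matrix P Q ℂ}
    {U : Matrix (P ⊕ Q) (P ⊕ Q) ℂ} {U₁ : Matrix P P ℂ} {U₂ : Matrix Q Q ℂ}
    {d : P ⊕ Q → ℝ} {d₁ : P → ℝ} {d₂ : Q → ℝ}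
    (h : IsDiagonalizedBy (fromBlocks H₁ F Fᴴ H₂) U d)
    (h₁ : IsDiagonalizedBy H₁ U₁ d₁) (h₂ : IsDiagonalizedBy H₂ U₂ d₂)
    {ε α β τ : ℝ} (hF : ∀ z, normSq (F *ᵥ z) ≤ ε ^ 2 * normSq z)
    (hα : α ≤ τ) (hβ : β ≤ τ) (hτ : ε ^ 2 ≤ (τ - α) * (τ - β)) :
    Fintype.card {i // τ < d i} ≤ Fintype.card {i // α < d₁ i} + Fintype.card {i // β < d₂ i} := by
  by_contra hlt
  -- `vec` parametrizes the span of the eigenvectors with eigenvalue above `τ`; `L₁` and `L₂` read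
  -- off the block coordinates above `α` and `β`. If the inequality failed, some nonzero vector of
  -- the span would be killed by both, and its quadratic form would be both above and at most `τ`
  -- times its squared norm.
  let ext : ({i // τ < d i} → ℂ) →ₗ[ℂ] (P ⊕ Q → ℂ) :=
    Function.ExtendByZero.linearMap ℂ Subtype.val
  let vec := U.mulVecLin ∘ₗ ext
  let L₁ : ({i // τ < d i} → ℂ) →ₗ[ℂ] ({i // α < d₁ i} → ℂ) :=
    LinearMap.funLeft ℂ ℂ Subtype.val ∘ₗ U₁ᴴ.mulVecLin ∘ₗ LinearMap.funLeft ℂ ℂ Sum.inl ∘ₗ vec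
  let L₂ : ({i // τ < d i} → ℂ) →ₗ[ℂ] ({i // β < d₂ i} → ℂ) :=
    LinearMap.funLeft ℂ ℂ Subtype.val ∘ₗ U₂ᴴ.mulVecLin ∘ₗ LinearMap.funLeft ℂ ℂ Sum.inr ∘ₗ vec
  have hker : LinearMap.ker (L₁.prod L₂) ≠ ⊥ := by
    apply LinearMap.ker_ne_bot_of_finrank_lt
    rw [Module.finrank_prod, Module.finrank_fintype_fun_eq_card,
      Module.finrank_fintype_fun_eq_card, Module.finrank_fintype_fun_eq_card]
    omega
  obtain ⟨c, hc, hc0⟩ := Submodule.exists_mem_ne_zero_of_ne_bot hker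
  have hcp := LinearMap.mem_ker.1 hc
  have hc1 : L₁ c = 0 := congrArg Prod.fst hcp
  have hc2 : L₂ c = 0 := congrArg Prod.snd hcp
  have hco : Uᴴ *ᵥ vec c = ext c := by
    change Uᴴ *ᵥ (U *ᵥ ext c) = ext c
    rw [mulVec_mulVec, h.conjTranspose_mul, one_mulVec]
  have hext : ∀ i : {i // τ < d i}, ext c i = c i := fun i =>
    Subtype.val_injective.extend_apply c 0 i
  have hv0 : vec c ≠ 0 := by
    intro h0
    apply hc0
    funext i
    rw [← hext, ← hco, h0, mulVec_zero]
    rfl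
  have hlow := h.lt_form (τ := τ) hv0 fun i hi => by
    rw [hco]
    exact Function.extend_apply' (f := (Subtype.val : {i // τ < d i} → P ⊕ Q)) c 0 i
      (by rintro ⟨a, rfl⟩; exact hi a.2)
  have hup := form_fromBlocks_le hF hα hβ hτ (x := vec c)
    (h₁.form_le fun i hi => congrFun hc1 ⟨i, hi⟩) (h₂.form_le fun i hi => congrFun hc2 ⟨i, hi⟩)
  exact absurd hlow (not_lt.2 hup)

theorem card_subtype_eq_countP (d : P → ℝ) (p : ℝ → Prop) [DecidablePred p] :
    Fintype.card {i // p (d i)} = (Finset.univ.val.map d).countP p := by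
  rw [Multiset.countP_map, Fintype.card_subtype]
  rfl

variable {H₁ : Matrix P P ℂ} {H₂ : Matrix Q Q ℂ} {F : Matrix P Q ℂ} {ε α β τ : ℝ}

theorem countP_gt_eigs_fromBlocks_le (hH₁ : H₁.IsHermitian) (hH₂ : H₂.IsHermitian)
    (hF : ∀ z, normSq (F *ᵥ z) ≤ ε ^ 2 * normSq z)
    (hα : α ≤ τ) (hβ : β ≤ τ) (hτ : ε ^ 2 ≤ (τ - α) * (τ - β)) :
    (eigs (fromBlocks H₁ F Fᴴ H₂)).countP (τ < ·) ≤
      (eigs H₁).countP (α < ·) + (eigs H₂).countP (β < ·) := by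
  have hH : (fromBlocks H₁ F Fᴴ H₂).IsHermitian := hH₁.fromBlocks rfl hH₂
  obtain ⟨U, h⟩ := exists_isDiagonalizedBy hH
  obtain ⟨U₁, h₁⟩ := exists_isDiagonalizedBy hH₁
  obtain ⟨U₂, h₂⟩ := exists_isDiagonalizedBy hH₂
  rw [eigs_eq hH, eigs_eq hH₁, eigs_eq hH₂, ← card_subtype_eq_countP, ← card_subtype_eq_countP,
    ← card_subtype_eq_countP]
  exact h.card_lt_le h₁ h₂ hF hα hβ hτ

theorem countP_lt_eigs_fromBlocks_le (hH₁ : H₁.IsHermitian) (hH₂ : H₂.IsHermitian)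
    (hF : ∀ z, normSq (F *ᵥ z) ≤ ε ^ 2 * normSq z)
    (hα : τ ≤ α) (hβ : τ ≤ β) (hτ : ε ^ 2 ≤ (α - τ) * (β - τ)) :
    (eigs (fromBlocks H₁ F Fᴴ H₂)).countP (· < τ) ≤
      (eigs H₁).countP (· < α) + (eigs H₂).countP (· < β) := by
  have hH : (fromBlocks H₁ F Fᴴ H₂).IsHermitian := hH₁.fromBlocks rfl hH₂
  obtain ⟨U, h⟩ := exists_isDiagonalizedBy hH
  obtain ⟨U₁, h₁⟩ := exists_isDiagonalizedBy hH₁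
  obtain ⟨U₂, h₂⟩ := exists_isDiagonalizedBy hH₂
  rw [eigs_eq hH, eigs_eq hH₁, eigs_eq hH₂, ← card_subtype_eq_countP, ← card_subtype_eq_countP,
    ← card_subtype_eq_countP]
  -- Negating the matrix exchanges "below" and "above".
  have hn := h.neg
  rw [fromBlocks_neg, ← conjTranspose_neg] at hn
  have hF' : ∀ z, normSq (-F *ᵥ z) ≤ ε ^ 2 * normSq z := fun z => by
    simpa [neg_mulVec, normSq] using hF z
  have := hn.card_lt_le h₁.neg h₂.neg hF' (neg_le_neg hα) (neg_le_neg hβ)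
    (by linarith : ε ^ 2 ≤ (-τ - -α) * (-τ - -β))
  simpa only [Pi.neg_apply, neg_lt_neg_iff] using this

end Counting

/-! ### Singular values through counts, ranks and distances -/

section SingularValues

variable {P Q : Type*} [Fintype P] [Fintype Q] [DecidableEq P] [DecidableEq Q]

theorem mem_svSet_iff (M : Matrix P Q ℂ) (x : ℝ) : x ∈ svSet M ↔ x ∈ svs M := by
  simp [svSet, svs]

theorem nonneg_of_mem_svs {M : Matrix P Q ℂ} {x : ℝ} (h : x ∈ svs M) : 0 ≤ x := by
  obtain ⟨i, rfl⟩ := (mem_svSet_iff M x).2 h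
  exact sv_nonneg M i

/-- A predicate false on `x ≤ 0` sees neither the padding zeros nor the negatives `-σ`. -/
theorem countP_svs_eq (M : Matrix P Q ℂ) (p : ℝ → Prop) [DecidablePred p]
    (h0 : ∀ x ≤ 0, ¬ p x) : (svs M).countP p = (eigs (wielandt M)).countP p := by
  have h := congrArg (Multiset.countP p) (eigs_wielandt M)
  have hrep : ∀ r, (Multiset.replicate r (0 : ℝ)).countP p = 0 := fun r =>
    Multiset.countP_eq_zero.2 fun x hx => h0 x (Multiset.eq_of_mem_replicate hx).le
  have hneg : ((svs M).map Neg.neg).countP p = 0 :=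
    Multiset.countP_eq_zero.2 fun x hx => by
      obtain ⟨y, hy, rfl⟩ := Multiset.mem_map.1 hx
      exact h0 _ (neg_nonpos.2 (nonneg_of_mem_svs hy))
  simpa [Multiset.countP_add, hrep, hneg] using h.symm

theorem mem_svSet_iff_mem_eigs_wielandt {M : Matrix P Q ℂ} {x : ℝ} (hx : 0 < x) :
    x ∈ svSet M ↔ x ∈ eigs (wielandt M) := by
  have h := countP_svs_eq M (x = ·) (by rintro y hy rfl; exact absurd hx (not_lt.2 hy))
  rw [mem_svSet_iff, ← Multiset.count_pos, ← Multiset.count_pos]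
  exact (congrArg (0 < ·) h).to_iff

theorem abs_mem_svSet_of_mem_eigs {M : Matrix P Q ℂ} {x : ℝ} (hx : x ∈ eigs (wielandt M)) :
    |x| ∈ svSet M := by
  rw [mem_svSet_iff]
  have h := eigs_wielandt M
  rcases eq_or_ne x 0 with rfl | hne
  -- If `0` were not a singular value, zero would be counted `min` times on the right of
  -- `eigs_wielandt`, but at least `max + 1` times on the left.
  · by_contra hc
    rw [abs_zero] at hc
    have h0 := congrArg (Multiset.count 0) h
    have hneg : ((svs M).map Neg.neg).count 0 = 0 := by
      rw [Multiset.count_eq_zero]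
      intro hm
      obtain ⟨y, hy, hy0⟩ := Multiset.mem_map.1 hm
      rw [neg_eq_zero.1 hy0] at hy
      exact hc hy
    have hpos := Multiset.count_pos.2 hx
    simp only [Multiset.count_add, Multiset.count_replicate_self, Multiset.count_eq_zero.2 hc,
      hneg] at h0
    have := min_le_max (a := Fintype.card P) (b := Fintype.card Q)
    omega
  · have hm : x ∈ Multiset.replicate (min (Fintype.card P) (Fintype.card Q)) (0 : ℝ) +
        (svs M + (svs M).map Neg.neg) := h ▸ Multiset.mem_add.2 (Or.inr hx)
    rcases Multiset.mem_add.1 hm with hm | hm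
    · exact absurd (Multiset.eq_of_mem_replicate hm) hne
    rcases Multiset.mem_add.1 hm with hm | hm
    · rwa [abs_of_nonneg (nonneg_of_mem_svs hm)]
    · obtain ⟨y, hy, rfl⟩ := Multiset.mem_map.1 hm
      rwa [abs_neg, abs_of_nonneg (nonneg_of_mem_svs hy)]

/-- The indices where an upward closed predicate holds form an initial segment, so comparing one
entry with a threshold is the same as counting. -/
theorem apply_iff_lt_card_of_antitone {N : ℕ} {f : Fin N → ℝ} (hf : Antitone f) {p : ℝ → Prop}
    [DecidablePred p] (hp : ∀ x y, x ≤ y → p x → p y) (i : Fin N) :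
    p (f i) ↔ (i : ℕ) < (Finset.univ.val.map f).countP p := by
  rw [← card_subtype_eq_countP, Fintype.card_subtype]
  constructor
  · intro h
    have : Finset.Iic i ⊆ Finset.univ.filter fun j => p (f j) := fun j hj =>
      Finset.mem_filter.2 ⟨Finset.mem_univ j, hp _ _ (hf (Finset.mem_Iic.1 hj)) h⟩
    have := Finset.card_le_card this
    rw [Fin.card_Iic] at this
    omega
  · intro h
    by_contra hc
    have : (Finset.univ.filter fun j => p (f j)) ⊆ Finset.Iio i := fun j hj =>
      Finset.mem_Iio.2 (lt_of_not_ge fun hij => hc (hp _ _ (hf hij) (Finset.mem_filter.1 hj).2))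
    have := Finset.card_le_card this
    rw [Fin.card_Iio] at this
    omega

theorem sv_gt_iff (M : Matrix P Q ℂ) (c : ℝ) (i) :
    c < sv M i ↔ (i : ℕ) < (svs M).countP (c < ·) :=
  apply_iff_lt_card_of_antitone (sv_antitone M) (p := (c < ·)) (fun _ _ h h' => h'.trans_le h) i

theorem sv_ge_iff (M : Matrix P Q ℂ) (c : ℝ) (i) :
    c ≤ sv M i ↔ (i : ℕ) < (svs M).countP (c ≤ ·) :=
  apply_iff_lt_card_of_antitone (sv_antitone M) (p := (c ≤ ·)) (fun _ _ h h' => h'.trans h) i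

/-- The number of positive singular values. -/
noncomputable def svRank (M : Matrix P Q ℂ) : ℕ := (svs M).countP (0 < ·)

theorem sv_eq_zero_iff (M : Matrix P Q ℂ) (i) : sv M i = 0 ↔ svRank M ≤ i := by
  rw [svRank, ← not_lt, ← sv_gt_iff, not_lt]
  exact ⟨le_of_eq, fun h => le_antisymm h (sv_nonneg M i)⟩

theorem zero_mem_svSet_iff (M : Matrix P Q ℂ) :
    0 ∈ svSet M ↔ svRank M < max (Fintype.card P) (Fintype.card Q) := by
  constructor
  · rintro ⟨i, hi⟩
    exact ((sv_eq_zero_iff M i).1 hi).trans_lt i.2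
  · intro h
    exact ⟨⟨_, h⟩, (sv_eq_zero_iff M _).2 le_rfl⟩

theorem card_pos_eigenvalues₀_le_rank {A : Matrix P P ℂ} (hA : A.IsHermitian) :
    Fintype.card {i // 0 < hA.eigenvalues₀ i} ≤ A.rank := by
  rw [hA.rank_eq_card_non_zero_eigs]
  let e : Fin (Fintype.card P) ≃ P := Fintype.equivOfCardEq (Fintype.card_fin _)
  refine Fintype.card_le_of_injective
    (fun i : {i // 0 < hA.eigenvalues₀ i} => ⟨e i.1, ?_⟩) fun i j hij => ?_
  · have h := i.2.ne'
    simpa [IsHermitian.eigenvalues, e] using h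
  · exact Subtype.ext (e.injective (congrArg Subtype.val hij))

open scoped ComplexOrder in
theorem svRank_le_rank (M : Matrix P Q ℂ) : svRank M ≤ M.rank := by
  rw [svRank, svs, ← card_subtype_eq_countP]
  by_cases h : Fintype.card Q ≤ Fintype.card P
  · rw [← rank_self_mul_conjTranspose M]
    refine le_trans ?_ (card_pos_eigenvalues₀_le_rank (isHermitian_mul_conjTranspose_self M))
    refine Fintype.card_le_of_injective
      (fun i : {i // 0 < sv M i} => ⟨i.1.cast (max_eq_left h), ?_⟩) fun i j hij => ?_
    · have h1 := i.2
      rw [sv, dif_pos h] at h1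
      exact Real.sqrt_pos.1 h1
    · simpa [Subtype.ext_iff, Fin.ext_iff] using hij
  · rw [← rank_conjTranspose_mul_self M]
    refine le_trans ?_ (card_pos_eigenvalues₀_le_rank (isHermitian_conjTranspose_mul_self M))
    refine Fintype.card_le_of_injective
      (fun i : {i // 0 < sv M i} => ⟨i.1.cast (max_eq_right (le_of_not_ge h)), ?_⟩)
      fun i j hij => ?_
    · have h1 := i.2
      rw [sv, dif_neg h] at h1
      exact Real.sqrt_pos.1 h1
    · simpa [Subtype.ext_iff, Fin.ext_iff] using hij

theorem svRank_le_min (M : Matrix P Q ℂ) :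
    svRank M ≤ min (Fintype.card P) (Fintype.card Q) :=
  (svRank_le_rank M).trans (le_min (rank_le_card_height M) (rank_le_card_width M))

theorem svDist_nonneg (x : ℝ) (M : Matrix P Q ℂ) : 0 ≤ svDist x M :=
  Real.iInf_nonneg fun _ => abs_nonneg _

theorem svDist_le {x y : ℝ} {M : Matrix P Q ℂ} (hy : y ∈ svSet M) : svDist x M ≤ |x - y| := by
  obtain ⟨j, rfl⟩ := hy
  exact ciInf_le (Set.finite_range _).bddBelow j

theorem exists_svDist_eq [Nonempty P] (x : ℝ) (M : Matrix P Q ℂ) :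
    ∃ y ∈ svSet M, svDist x M = |x - y| := by
  have : Nonempty (Fin (max (Fintype.card P) (Fintype.card Q))) :=
    ⟨⟨0, lt_max_of_lt_left Fintype.card_pos⟩⟩
  obtain ⟨j, hj⟩ := exists_eq_ciInf_of_finite (f := fun j => |x - sv M j|)
  exact ⟨_, ⟨j, rfl⟩, hj.symm⟩

/-- Since `x ≥ 0`, reflecting a negative eigenvalue to `|e|` only brings it closer, so a gap from
the singular values is also a gap from the whole spectrum. -/
theorem svDist_le_abs_sub_eig {x e : ℝ} (hx : 0 ≤ x) {M : Matrix P Q ℂ}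
    (he : e ∈ eigs (wielandt M)) : svDist x M ≤ |x - e| :=
  (svDist_le (abs_mem_svSet_of_mem_eigs he)).trans <| by
    simpa [abs_of_nonneg hx] using abs_abs_sub_abs_le_abs_sub x e

end SingularValues

/-! ### The bound as a root of a quadratic -/

section Bound

theorem bound_eq {ε η : ℝ} (hη : 0 ≤ η) : bound ε η = (√(η ^ 2 + 4 * ε ^ 2) - η) / 2 := by
  have hs := Real.sq_sqrt (by positivity : 0 ≤ η ^ 2 + 4 * ε ^ 2)
  have hs0 := Real.sqrt_nonneg (η ^ 2 + 4 * ε ^ 2)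
  rw [bound]
  rcases eq_or_ne (η + √(η ^ 2 + 4 * ε ^ 2)) 0 with h | h
  -- The denominator vanishes only if both summands do, and then both sides are `0`.
  · rw [h, div_zero]
    linarith
  · rw [div_eq_iff h]
    linarith

theorem bound_nonneg {ε η : ℝ} (hη : 0 ≤ η) : 0 ≤ bound ε η := by
  unfold bound; positivity

/-- This is the equality case of the threshold condition in the counting lemmas. -/
theorem bound_mul_self_add {ε η : ℝ} (hη : 0 ≤ η) : bound ε η * (bound ε η + η) = ε ^ 2 := by
  have hs := Real.sq_sqrt (by positivity : 0 ≤ η ^ 2 + 4 * ε ^ 2)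
  rw [bound_eq hη]
  linarith

theorem bound_antitone {ε η η' : ℝ} (hη : 0 ≤ η) (h : η ≤ η') : bound ε η' ≤ bound ε η := by
  have h1 := bound_mul_self_add (ε := ε) hη
  have h2 := bound_mul_self_add (ε := ε) (hη.trans h)
  have h3 := bound_nonneg (ε := ε) hη
  have h4 := bound_nonneg (ε := ε) (hη.trans h)
  by_contra hc
  push Not at hc
  nlinarith [mul_nonneg h4 (sub_nonneg.2 h)]

end Bound

/-! ### The block matrix, its gaps and the perturbation estimates -/

section Blocks

variable {m n k l : ℕ} (G₁ : Matrix (Fin m) (Fin k) ℂ) (E₁ : Matrix (Fin m) (Fin l) ℂ)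
  (E₂ : Matrix (Fin n) (Fin k) ℂ) (G₂ : Matrix (Fin n) (Fin l) ℂ)

theorem eigs_wielandt_fromBlocks :
    eigs (wielandt (fromBlocks G₁ E₁ E₂ G₂)) =
      eigs (fromBlocks (wielandt G₁) (fromBlocks 0 E₁ E₂ᴴ 0) (fromBlocks 0 E₁ E₂ᴴ 0)ᴴ
        (wielandt G₂)) := by
  rw [← eigs_reindex (Equiv.sumSumSumComm (Fin m) (Fin n) (Fin k) (Fin l))]
  congr 1
  ext ((i | i) | (i | i)) ((j | j) | (j | j)) <;> simp [wielandt]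

theorem eigs_wielandt_diagBlocks :
    eigs (wielandt (diagBlocks G₁ G₂)) = eigs (wielandt G₁) + eigs (wielandt G₂) := by
  rw [diagBlocks, eigs_wielandt_fromBlocks, ← eigs_fromBlocks_diag]
  simp

theorem normSq_offDiag_mulVec_le {ε : ℝ} (h₁ : ‖E₁‖ ≤ ε) (h₂ : ‖E₂‖ ≤ ε)
    (z : Fin n ⊕ Fin l → ℂ) :
    normSq (fromBlocks 0 E₁ E₂ᴴ 0 *ᵥ z) ≤ ε ^ 2 * normSq z := by
  have key : ∀ {p q : ℕ} (E : Matrix (Fin p) (Fin q) ℂ) (x), ‖E‖ ≤ ε →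
      normSq (E *ᵥ x) ≤ ε ^ 2 * normSq x := fun E x hE =>
    (normSq_mulVec_le E x).trans (mul_le_mul_of_nonneg_right
      (pow_le_pow_left₀ (norm_nonneg _) hE 2) (normSq_nonneg x))
  have e1 := key E₁ (z ∘ Sum.inr) h₁
  have e2 := key E₂ᴴ (z ∘ Sum.inl) (by rwa [l2_opNorm_conjTranspose])
  rw [fromBlocks_mulVec, normSq_sum, normSq_sum z]
  simp only [Sum.elim_comp_inl, Sum.elim_comp_inr, zero_mulVec, zero_add, add_zero]
  linarith

/-- Zero has to be excluded: `max (m + n) (k + l)` may be smaller than the total number of singular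
values of the two blocks. -/
theorem countP_svs_diagBlocks (p : ℝ → Prop) [DecidablePred p] (h0 : ∀ x ≤ 0, ¬ p x) :
    (svs (diagBlocks G₁ G₂)).countP p = (svs G₁).countP p + (svs G₂).countP p := by
  rw [countP_svs_eq _ p h0, countP_svs_eq _ p h0, countP_svs_eq _ p h0,
    eigs_wielandt_diagBlocks, Multiset.countP_add]

theorem svRank_diagBlocks : svRank (diagBlocks G₁ G₂) = svRank G₁ + svRank G₂ :=
  countP_svs_diagBlocks G₁ G₂ (0 < ·) fun _ => not_lt.2

theorem mem_svSet_diagBlocks {x : ℝ} (hx : 0 < x) :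
    x ∈ svSet (diagBlocks G₁ G₂) ↔ x ∈ svSet G₁ ∨ x ∈ svSet G₂ := by
  rw [mem_svSet_iff_mem_eigs_wielandt hx, mem_svSet_iff_mem_eigs_wielandt hx,
    mem_svSet_iff_mem_eigs_wielandt hx, eigs_wielandt_diagBlocks, Multiset.mem_add]

theorem sv_diagBlocks_mem (i : Idx m n k l) :
    sv (diagBlocks G₁ G₂) i ∈ svSet G₁ ∪ svSet G₂ := by
  rcases (sv_nonneg (diagBlocks G₁ G₂) i).eq_or_lt with h | h
  -- If `0` were absent from both blocks, their ranks would sum to at least `max (m + n) (k + l)`,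
  -- leaving no index for a zero.
  · have h1 := (sv_eq_zero_iff _ i).1 h.symm
    have hi := i.2
    rw [← h, Set.mem_union, zero_mem_svSet_iff, zero_mem_svSet_iff]
    rw [svRank_diagBlocks] at h1
    simp only [Fintype.card_sum, Fintype.card_fin] at hi ⊢
    omega
  · exact (mem_svSet_diagBlocks G₁ G₂ h).1 ⟨i, rfl⟩

theorem sv_eq_zero_of_min_le (M : Matrix (Fin m ⊕ Fin n) (Fin k ⊕ Fin l) ℂ) {i : Idx m n k l}
    (hi : min (m + n) (k + l) ≤ (i : ℕ)) : sv M i = 0 := by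
  have := svRank_le_min M
  simp only [Fintype.card_sum, Fintype.card_fin] at this
  exact (sv_eq_zero_iff M i).2 (this.trans hi)

theorem gap_nonneg (i : Idx m n k l) : 0 ≤ gap G₁ G₂ i := by
  unfold gap; split_ifs <;> exact svDist_nonneg _ _

theorem gap_le {i : Idx m n k l} {x y : ℝ} (hx : x ∈ svSet G₁) (hy : y ∈ svSet G₂)
    (hi : sv (diagBlocks G₁ G₂) i = x ∨ sv (diagBlocks G₁ G₂) i = y) :
    gap G₁ G₂ i ≤ |x - y| := by
  unfold gap
  split_ifs with h
  · rcases hi with hi | hi <;> rw [hi]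
    · exact svDist_le hy
    · exact (svDist_le hy).trans (by simp)
  · rcases hi with hi | hi
    · exact absurd (hi ▸ hx) h
    · rw [hi, abs_sub_comm]
      exact svDist_le hx

theorem pairGap_nonneg : 0 ≤ pairGap G₁ G₂ := Real.iInf_nonneg fun _ => svDist_nonneg _ _

theorem pairGap_le {x y : ℝ} (hx : x ∈ svSet G₁) (hy : y ∈ svSet G₂) :
    pairGap G₁ G₂ ≤ |x - y| := by
  obtain ⟨j, rfl⟩ := hx
  exact (ciInf_le (Set.finite_range _).bddBelow j).trans (svDist_le hy)

theorem exists_pairGap_eq (hm : 0 < m) (hn : 0 < n) :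
    ∃ x ∈ svSet G₁, ∃ y ∈ svSet G₂, pairGap G₁ G₂ = |x - y| := by
  have : Nonempty (Fin n) := ⟨⟨0, hn⟩⟩
  have : Nonempty (Fin (max (Fintype.card (Fin m)) (Fintype.card (Fin k)))) :=
    ⟨⟨0, lt_max_of_lt_left (by simpa using hm)⟩⟩
  obtain ⟨j, hj⟩ := exists_eq_ciInf_of_finite (f := fun j => svDist (sv G₁ j) G₂)
  obtain ⟨y, hy, h⟩ := exists_svDist_eq (sv G₁ j) G₂
  exact ⟨_, ⟨j, rfl⟩, y, hy, hj.symm.trans h⟩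

theorem pairGap_le_gap (hm : 0 < m) (hn : 0 < n) (i : Idx m n k l) :
    pairGap G₁ G₂ ≤ gap G₁ G₂ i := by
  have : Nonempty (Fin m) := ⟨⟨0, hm⟩⟩
  have : Nonempty (Fin n) := ⟨⟨0, hn⟩⟩
  unfold gap
  split_ifs with h
  · obtain ⟨y, hy, e⟩ := exists_svDist_eq (sv (diagBlocks G₁ G₂) i) G₂
    rw [e]
    exact pairGap_le G₁ G₂ h hy
  · obtain ⟨y, hy, e⟩ := exists_svDist_eq (sv (diagBlocks G₁ G₂) i) G₁
    rw [e, abs_sub_comm]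
    exact pairGap_le G₁ G₂ hy ((sv_diagBlocks_mem G₁ G₂ i).resolve_left h)

theorem pairGap_le_minGap (hm : 0 < m) (hn : 0 < n) (hk : 0 < k) :
    pairGap G₁ G₂ ≤ minGap G₁ G₂ := by
  have : Nonempty {i : Idx m n k l // (i : ℕ) < min (m + n) (k + l)} :=
    ⟨⟨⟨0, by simp only [Fintype.card_sum, Fintype.card_fin]; omega⟩, by
      change 0 < _; omega⟩⟩
  exact le_ciInf fun i => pairGap_le_gap G₁ G₂ hm hn i.1

theorem minGap_le_gap {i : Idx m n k l} (hi : (i : ℕ) < min (m + n) (k + l)) :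
    minGap G₁ G₂ ≤ gap G₁ G₂ i :=
  ciInf_le (f := fun i : {i : Idx m n k l // (i : ℕ) < min (m + n) (k + l)} => gap G₁ G₂ i.1)
    (Set.finite_range _).bddBelow ⟨i, hi⟩

/-- A positive member of the pair always occurs among the first `min (m + n) (k + l)` indices. If
both are `0`, a zero is needed there too, which can fail when both blocks are strictly tall or both
strictly wide. -/
theorem exists_sv_diagBlocks_eq {x y : ℝ} (hx : x ∈ svSet G₁) (hy : y ∈ svSet G₂)
    (h₁ : ¬ (k < m ∧ l < n)) (h₂ : ¬ (m < k ∧ n < l)) :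
    ∃ i : Idx m n k l, (i : ℕ) < min (m + n) (k + l) ∧
      (sv (diagBlocks G₁ G₂) i = x ∨ sv (diagBlocks G₁ G₂) i = y) := by
  have hpos : ∀ {i : Idx m n k l}, 0 < sv (diagBlocks G₁ G₂) i →
      (i : ℕ) < min (m + n) (k + l) := fun {i} h => by
    by_contra hc
    exact h.ne' (sv_eq_zero_of_min_le _ (not_lt.1 hc))
  have hx0 := nonneg_of_mem_svs ((mem_svSet_iff _ _).1 hx)
  have hy0 := nonneg_of_mem_svs ((mem_svSet_iff _ _).1 hy)
  rcases hx0.eq_or_lt with rfl | hx0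
  · rcases hy0.eq_or_lt with rfl | hy0
    · rw [zero_mem_svSet_iff] at hx hy
      have r₁ := svRank_le_min G₁
      have r₂ := svRank_le_min G₂
      have r := svRank_diagBlocks G₁ G₂
      simp only [Fintype.card_fin] at hx hy r₁ r₂
      -- Each rank is at most the smaller side of its block and strictly less than the larger one;
      -- outside the excluded shapes this forces the sum below both `m + n` and `k + l`.
      have hlt : svRank (diagBlocks G₁ G₂) < min (m + n) (k + l) := by omega
      refine ⟨⟨svRank (diagBlocks G₁ G₂), ?_⟩, hlt, Or.inl ((sv_eq_zero_iff _ _).2 le_rfl)⟩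
      simp only [Fintype.card_sum, Fintype.card_fin]
      omega
    · obtain ⟨i, hi⟩ := (mem_svSet_diagBlocks G₁ G₂ hy0).2 (Or.inr hy)
      exact ⟨i, hpos (hi ▸ hy0), Or.inr hi⟩
  · obtain ⟨i, hi⟩ := (mem_svSet_diagBlocks G₁ G₂ hx0).2 (Or.inl hx)
    exact ⟨i, hpos (hi ▸ hx0), Or.inl hi⟩

theorem minGap_eq_pairGap (hm : 0 < m) (hn : 0 < n) (hk : 0 < k)
    (h₁ : ¬ (k < m ∧ l < n)) (h₂ : ¬ (m < k ∧ n < l)) : minGap G₁ G₂ = pairGap G₁ G₂ := by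
  refine le_antisymm ?_ (pairGap_le_minGap G₁ G₂ hm hn hk)
  obtain ⟨x, hx, y, hy, e⟩ := exists_pairGap_eq G₁ G₂ hm hn
  obtain ⟨i, hi, hxy⟩ := exists_sv_diagBlocks_eq G₁ G₂ hx hy h₁ h₂
  rw [e]
  exact (minGap_le_gap G₁ G₂ hi).trans (gap_le G₁ G₂ hx hy hxy)

/-- One of the blocks has no eigenvalue at distance less than `gap` from the given singular
value. -/
theorem gap_le_abs_sub_eig (i : Idx m n k l) :
    (∀ e ∈ eigs (wielandt G₂), gap G₁ G₂ i ≤ |sv (diagBlocks G₁ G₂) i - e|) ∨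
      (∀ e ∈ eigs (wielandt G₁), gap G₁ G₂ i ≤ |sv (diagBlocks G₁ G₂) i - e|) := by
  unfold gap
  split_ifs with h
  · exact Or.inl fun e he => svDist_le_abs_sub_eig (sv_nonneg _ i) he
  · exact Or.inr fun e he => svDist_le_abs_sub_eig (sv_nonneg _ i) he

/-- An element in `(μ - g, μ]` would lie closer to `μ` than `g`. -/
theorem countP_gt_sub_eq {s : Multiset ℝ} {μ g : ℝ} (hg : 0 ≤ g) (h : ∀ e ∈ s, g ≤ |μ - e|) :
    s.countP (μ - g < ·) = s.countP (μ < ·) := by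
  refine Multiset.countP_congr rfl fun e he => propext ⟨fun h1 => ?_, fun h1 => ?_⟩
  · by_contra hc
    have := h e he
    rw [abs_of_nonneg (by linarith)] at this
    linarith
  · linarith

theorem countP_lt_add_eq {s : Multiset ℝ} {μ g : ℝ} (hg : 0 ≤ g) (h : ∀ e ∈ s, g ≤ |μ - e|) :
    s.countP (· < μ + g) = s.countP (· < μ) := by
  refine Multiset.countP_congr rfl fun e he => propext ⟨fun h1 => ?_, fun h1 => ?_⟩
  · by_contra hc
    have := h e he
    rw [abs_of_nonpos (by linarith)] at this
    linarith
  · linarith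

theorem countP_ge_add_countP_lt (s : Multiset ℝ) (c : ℝ) :
    s.countP (c ≤ ·) + s.countP (· < c) = s.card := by
  rw [Multiset.card_eq_countP_add_countP (c ≤ ·)]
  simp only [not_le]

variable {ε : ℝ}

theorem sv_fromBlocks_le (h₁ : ‖E₁‖ ≤ ε) (h₂ : ‖E₂‖ ≤ ε) (i : Idx m n k l) :
    sv (fromBlocks G₁ E₁ E₂ G₂) i ≤ sv (diagBlocks G₁ G₂) i + bound ε (gap G₁ G₂ i) := by
  have hg := gap_nonneg G₁ G₂ i
  have hδ := bound_nonneg (ε := ε) hg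
  have hmul := bound_mul_self_add (ε := ε) hg
  have hμ := sv_nonneg (diagBlocks G₁ G₂) i
  have hF := normSq_offDiag_mulVec_le E₁ E₂ h₁ h₂
  have key : (eigs (wielandt (fromBlocks G₁ E₁ E₂ G₂))).countP
      (sv (diagBlocks G₁ G₂) i + bound ε (gap G₁ G₂ i) < ·) ≤
      (eigs (wielandt (diagBlocks G₁ G₂))).countP (sv (diagBlocks G₁ G₂) i < ·) := by
    rw [eigs_wielandt_fromBlocks, eigs_wielandt_diagBlocks, Multiset.countP_add]
    -- Only the isolated block has its threshold lowered by the gap; the product condition is then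
    -- `hmul`.
    rcases gap_le_abs_sub_eig G₁ G₂ i with h | h <;> rw [← countP_gt_sub_eq hg h] <;>
      exact countP_gt_eigs_fromBlocks_le (wielandt_isHermitian G₁) (wielandt_isHermitian G₂) hF
        (by linarith) (by linarith) (by linarith)
  rw [← countP_svs_eq _ _ fun x hx => not_lt.2 (hx.trans (add_nonneg hμ hδ)),
    ← countP_svs_eq _ _ fun x hx => not_lt.2 (hx.trans hμ)] at key
  rw [← not_lt, sv_gt_iff]
  have := mt (sv_gt_iff (diagBlocks G₁ G₂) _ i).2 (lt_irrefl _)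
  omega

theorem le_sv_fromBlocks (h₁ : ‖E₁‖ ≤ ε) (h₂ : ‖E₂‖ ≤ ε) (i : Idx m n k l) :
    sv (diagBlocks G₁ G₂) i - bound ε (gap G₁ G₂ i) ≤ sv (fromBlocks G₁ E₁ E₂ G₂) i := by
  have hg := gap_nonneg G₁ G₂ i
  have hδ := bound_nonneg (ε := ε) hg
  have hmul := bound_mul_self_add (ε := ε) hg
  -- Counts of singular values and of eigenvalues agree only for positive thresholds; otherwise the
  -- claim is trivial.
  rcases le_or_gt (sv (diagBlocks G₁ G₂) i - bound ε (gap G₁ G₂ i)) 0 with hτ | hτ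
  · exact hτ.trans (sv_nonneg _ i)
  have hμ : 0 < sv (diagBlocks G₁ G₂) i := by linarith
  have hF := normSq_offDiag_mulVec_le E₁ E₂ h₁ h₂
  have key : (eigs (wielandt (fromBlocks G₁ E₁ E₂ G₂))).countP
      (· < sv (diagBlocks G₁ G₂) i - bound ε (gap G₁ G₂ i)) ≤
      (eigs (wielandt (diagBlocks G₁ G₂))).countP (· < sv (diagBlocks G₁ G₂) i) := by
    rw [eigs_wielandt_fromBlocks, eigs_wielandt_diagBlocks, Multiset.countP_add]
    rcases gap_le_abs_sub_eig G₁ G₂ i with h | h <;> rw [← countP_lt_add_eq hg h] <;>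
      exact countP_lt_eigs_fromBlocks_le (wielandt_isHermitian G₁) (wielandt_isHermitian G₂) hF
        (by linarith) (by linarith) (by linarith)
  -- Both Wielandt matrices have the same size, so complementing turns the bound on eigenvalues
  -- below into one on those at or above.
  have c1 := countP_ge_add_countP_lt (eigs (wielandt (fromBlocks G₁ E₁ E₂ G₂)))
    (sv (diagBlocks G₁ G₂) i - bound ε (gap G₁ G₂ i))
  have c2 := countP_ge_add_countP_lt (eigs (wielandt (diagBlocks G₁ G₂)))
    (sv (diagBlocks G₁ G₂) i)
  rw [card_eigs, ← countP_svs_eq _ _ fun x hx => not_le.2 (hx.trans_lt hτ)] at c1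
  rw [card_eigs, ← countP_svs_eq _ _ fun x hx => not_le.2 (hx.trans_lt hμ)] at c2
  rw [sv_ge_iff]
  have := (sv_ge_iff (diagBlocks G₁ G₂) _ i).1 le_rfl
  omega

end Blocks

end BlockSVD

/-! ### The main theorem -/

theorem theorem3 (m n k l : ℕ) (hm : 0 < m) (hn : 0 < n) (hk : 0 < k) (hl : 0 < l)
    (G₁ : Matrix (Fin m) (Fin k) ℂ) (E₁ : Matrix (Fin m) (Fin l) ℂ)
    (E₂ : Matrix (Fin n) (Fin k) ℂ) (G₂ : Matrix (Fin n) (Fin l) ℂ)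
    (B B' : Matrix (Fin m ⊕ Fin n) (Fin k ⊕ Fin l) ℂ)
    (hB : B = Matrix.fromBlocks G₁ E₁ E₂ G₂) (hB' : B' = BlockSVD.diagBlocks G₁ G₂)
    (ε : ℝ) (hε : ε = max ‖E₁‖ ‖E₂‖) :
    -- every `η_i` is well defined: each singular value of `B'` comes from one of the blocks
    (∀ i : BlockSVD.Idx m n k l, BlockSVD.sv B' i ∈ BlockSVD.svSet G₁ ∪ BlockSVD.svSet G₂) ∧
    -- the two descriptions of `η`, and when they agree
    BlockSVD.pairGap G₁ G₂ ≤ BlockSVD.minGap G₁ G₂ ∧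
    (¬ (k < m ∧ l < n) → ¬ (m < k ∧ n < l) →
      BlockSVD.minGap G₁ G₂ = BlockSVD.pairGap G₁ G₂) ∧
    -- the perturbation bounds, in which `η` may be read either way
    (∀ i : BlockSVD.Idx m n k l, (i : ℕ) < min (m + n) (k + l) →
      |BlockSVD.sv B i - BlockSVD.sv B' i| ≤ BlockSVD.bound ε (BlockSVD.gap G₁ G₂ i) ∧
      BlockSVD.bound ε (BlockSVD.gap G₁ G₂ i) ≤ BlockSVD.bound ε (BlockSVD.minGap G₁ G₂) ∧
      BlockSVD.bound ε (BlockSVD.minGap G₁ G₂) ≤ BlockSVD.bound ε (BlockSVD.pairGap G₁ G₂)) ∧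
    -- the remaining singular values
    (∀ i : BlockSVD.Idx m n k l, min (m + n) (k + l) ≤ (i : ℕ) → BlockSVD.sv B i = 0 ∧ BlockSVD.sv B' i = 0) := by
  subst hB hB' hε
  refine ⟨BlockSVD.sv_diagBlocks_mem G₁ G₂, BlockSVD.pairGap_le_minGap G₁ G₂ hm hn hk,
    BlockSVD.minGap_eq_pairGap G₁ G₂ hm hn hk, fun i hi => ⟨?_, ?_, ?_⟩,
    fun i hi => ⟨BlockSVD.sv_eq_zero_of_min_le _ hi, BlockSVD.sv_eq_zero_of_min_le _ hi⟩⟩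
  · have h₁ := BlockSVD.sv_fromBlocks_le G₁ E₁ E₂ G₂ (le_max_left _ _) (le_max_right _ _) i
    have h₂ := BlockSVD.le_sv_fromBlocks G₁ E₁ E₂ G₂ (le_max_left _ _) (le_max_right _ _) i
    exact abs_sub_le_iff.2 ⟨by linarith, by linarith⟩
  · exact BlockSVD.bound_antitone ((BlockSVD.pairGap_nonneg G₁ G₂).trans
      (BlockSVD.pairGap_le_minGap G₁ G₂ hm hn hk)) (BlockSVD.minGap_le_gap G₁ G₂ hi)
  · exact BlockSVD.bound_antitone (BlockSVD.pairGap_nonneg G₁ G₂)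
      (BlockSVD.pairGap_le_minGap G₁ G₂ hm hn hk)
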